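/- Let $K,\ell\ge 1$ and let $\boldsymbol\mu=(\mu^{(1)},\dots,\mu^{(K)})$ be a family of probability distributions on $\mathbb{Z}_+^K$. Write $\phi^{(i)}(x)=\sum_{k\in\mathbb{Z}_+^K}\mu^{(i)}(k)\,x_1^{k_1}\cdots x_K^{k_K}$ and let $M=(m_{i,j})$, $m_{i,j}=\sum_{z}z_j\,\mu^{(i)}(z)$, be the mean matrix. A family $\boldsymbol\zeta=(\zeta^{(i)})_{i\le K}$ of probability distributions on finite words over $\{1,\dots,K\}$ has projection $\boldsymbol\mu$ if $\mu^{(i)}$ is the law of the vector counting the letters of each type in a word of law $\zeta^{(i)}$. The $\boldsymbol\zeta$-BGW tree $\mathcal{T}_{\boldsymbol\zeta}^{(i)}$ is the random $K$-type plane tree whose root has type $i$ and in which, independently, the ordered list of the types of the children of a vertex of type $j$ has law $\zeta^{(j)}$; $\mathbf{N}$ denotes the vector of the numbers of its vertices of each type. Assume that $\boldsymbol\mu$ is * entire: each $\phi^{(i)}$ is entire, i.e. its series converges on all of $\mathbb{C}^K$; * finite: for a $\boldsymbol\zeta$ with projection $\boldsymbol\mu$, $\mathbb{P}(|\mathcal{T}_{\boldsymbol\zeta}^{(i)}|<\infty)>0$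 for all $i$; * nondegenerate: for some $i$, $\mu^{(i)}(\{z:\sum_j z_j\ge 2\})>0$; * nonlocalized: for every $X\in\mathbb{R}^K\setminus\{0\}$ there is $i$ such that $\sum_j X_jk_j$ is not almost surely constant when $k$ has law $\mu^{(i)}$; * irreducible: for all $i,j$ there is an integer $p\ge 1$ with $(M^p)_{i,j}>0$. For $\theta\in\mathbb{R}^K$ define the exponential tilting $\boldsymbol\mu_\theta$ by $\mu_\theta^{(i)}(k)=\mu^{(i)}(k)\,e^{\theta\cdot k}/\phi^{(i)}(e^{\theta_1},\dots,e^{\theta_K})$ and, for $\boldsymbol\zeta$ with projection $\boldsymbol\mu$, define $\boldsymbol\zeta_\theta$ by reweighting a word $w$ in the same way by $e^{\theta\cdot k(w)}$, where $k(w)$ is its vector of letter counts, and normalizing. Let $\chi_i(\theta)=\log\phi^{(i)}(e^{\theta_1},\dots,e^{\theta_K})-\theta_i$. For an integer $\ell\times K$ matrix $\Gamma$ write $\theta\sim_\Gamma\theta'$ if $\chi(\theta)-\chi(\theta')$ is orthogonal to $\ker\Gamma\subset\mathbb{R}^K$. A family is critical if the spectral radius of its mean matrix is $1$. Then for every nonzero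 integer matrix $\Gamma\in\mathbb{Z}^{\ell\times K}$ (possibly with negative entries) there is $\theta\in\mathbb{R}^K$ with $\theta\sim_\Gamma 0$ such that $\boldsymbol\mu_\theta$ is critical. Moreover, for this $\theta$ and every $\boldsymbol\zeta$ with projection $\boldsymbol\mu$, the family $\boldsymbol\zeta_\theta$ has the critical projection $\boldsymbol\mu_\theta$, and for every root type $i$ and every $g\in\mathbb{Z}^\ell$ the event $\{\Gamma\mathbf{N}=g\}$ (which includes that the tree is finite) has positive probability for $\mathcal{T}_{\boldsymbol\zeta}^{(i)}$ if and only if it does for $\mathcal{T}_{\boldsymbol\zeta_\theta}^{(i)}$; in that case the two trees conditioned on this event have the same law. -/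

import Mathlib

open scoped ENNReal

noncomputable section

namespace BGW

/-! ### Words, projections and tiltings -/

/-- Finite words on the set of types. -/
abbrev Word (K : ℕ) : Type := List (Fin K)

/-- The set of words is countable and carries the discrete σ-algebra. -/
instance instMeasurableSpaceWord (K : ℕ) : MeasurableSpace (Word K) := ⊤

instance instDiscreteWord (K : ℕ) : DiscreteMeasurableSpace (Word K) := ⟨fun _ => trivial⟩

/-- The projection of a family of distributions on words: the law of the vector counting the
letters of each type. -/
def projection {K : ℕ} (ζ : Fin K → PMF (Word K)) (i : Fin K) : PMF (Fin K → ℕ) :=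
  (ζ i).map (fun w j => w.count j)

open Classical in
/-- The distribution `p` reweighted by `exp f` and normalized: its mass at `a` is
`p a * exp (f a) / E_p[exp f]`. When `E_p[exp f] = ∞` the tilting does not exist and `p` is
returned. -/
def tilt {α : Type*} (p : PMF α) (f : α → ℝ) : PMF α :=
  if h : ∑' a, p a * ENNReal.ofReal (Real.exp (f a)) ≠ ∞ then
    PMF.normalize (fun a => p a * ENNReal.ofReal (Real.exp (f a)))
      (by
        obtain ⟨a, ha⟩ := p.support_nonempty
        intro h0
        have := ENNReal.tsum_eq_zero.1 h0 a
        simp only [mul_eq_zero, ENNReal.ofReal_eq_zero, not_le.2 (Real.exp_pos _), or_false] at this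
        exact (p.mem_support_iff a).1 ha this) h
  else p

/-- The exponential tilting `μ_θ` of a family of distributions on `ℕ^K`. -/
def tilting {K : ℕ} (μ : Fin K → PMF (Fin K → ℕ)) (θ : Fin K → ℝ) (i : Fin K) :
    PMF (Fin K → ℕ) :=
  tilt (μ i) (fun k => ∑ j, θ j * (k j : ℝ))

/-- The exponential tilting `ζ_θ` of a family of distributions on words. -/
def wordTilting {K : ℕ} (ζ : Fin K → PMF (Word K)) (θ : Fin K → ℝ) (i : Fin K) : PMF (Word K) :=
  tilt (ζ i) (fun w => ∑ j, θ j * (w.count j : ℝ))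

/-! ### Generating functions, mean matrix, `χ` and `Γ`-equivalence -/

/-- The generating function of the `i`-th distribution. -/
def genFun {K : ℕ} (μ : Fin K → PMF (Fin K → ℕ)) (i : Fin K) (x : Fin K → ℝ) : ℝ :=
  ∑' k : Fin K → ℕ, (μ i k).toReal * ∏ j, x j ^ k j

/-- The generating functions are entire: their power series converge (absolutely) on all of
`ℂ^K`. -/
def IsEntire {K : ℕ} (μ : Fin K → PMF (Fin K → ℕ)) : Prop :=
  ∀ (i : Fin K) (z : Fin K → ℂ),
    Summable (fun k : Fin K → ℕ => ((μ i k).toReal : ℂ) * ∏ j, z j ^ k j)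

/-- The mean matrix: its `(i, j)` entry is the mean of the `j`-th coordinate under `μ i`. -/
def meanMatrix {K : ℕ} (μ : Fin K → PMF (Fin K → ℕ)) : Matrix (Fin K) (Fin K) ℝ :=
  Matrix.of fun i j => ∑' z : Fin K → ℕ, (z j : ℝ) * (μ i z).toReal

/-- The (complex) spectral radius of the mean matrix is `1`. -/
def IsCritical {K : ℕ} (μ : Fin K → PMF (Fin K → ℕ)) : Prop :=
  spectralRadius ℂ ((meanMatrix μ).map (fun x : ℝ => (x : ℂ))) = 1

def IsNondegenerate {K : ℕ} (μ : Fin K → PMF (Fin K → ℕ)) : Prop :=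
  ∃ i, 0 < (μ i).toMeasure {z | 2 ≤ ∑ j, z j}

/-- No nonzero linear form is almost surely constant under every `μ i`. -/
def IsNonlocalized {K : ℕ} (μ : Fin K → PMF (Fin K → ℕ)) : Prop :=
  ∀ X : Fin K → ℝ, X ≠ 0 →
    ∃ i, ¬ ∃ c : ℝ, ∀ k ∈ (μ i).support, ∑ j, X j * (k j : ℝ) = c

def IsIrreducible {K : ℕ} (μ : Fin K → PMF (Fin K → ℕ)) : Prop :=
  ∀ i j, ∃ p : ℕ, 0 < p ∧ 0 < (meanMatrix μ ^ p) i j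

/-- `χ_i(θ) = log (φ_i(e^θ)) - θ_i`. -/
def chi {K : ℕ} (μ : Fin K → PMF (Fin K → ℕ)) (θ : Fin K → ℝ) : Fin K → ℝ :=
  fun i => Real.log (genFun μ i (fun j => Real.exp (θ j))) - θ i

/-- `χ(θ) - χ(θ')` is orthogonal to the real kernel of `Γ`. -/
def GammaEquiv {K l : ℕ} (μ : Fin K → PMF (Fin K → ℕ)) (Γ : Matrix (Fin l) (Fin K) ℤ)
    (θ θ' : Fin K → ℝ) : Prop :=
  ∀ v : Fin K → ℝ, (Γ.map (fun n : ℤ => (n : ℝ))).mulVec v = 0 →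
    dotProduct (chi μ θ - chi μ θ') v = 0

/-! ### Multitype plane trees -/

/-- A `K`-type plane tree, in Neveu's formalism with children numbered from `0`. It is encoded by
the function `label` on words of integers: `label u = some j` if `u` is a vertex of type `j`, and
`label u = none` if `u` is not a vertex. -/
@[ext]
structure Tree (K : ℕ) where
  label : List ℕ → Option (Fin K)
  root_mem : (label []).isSome
  ancestor_mem : ∀ u v : List ℕ, (label (u ++ v)).isSome → (label u).isSome
  children : ∀ u, (label u).isSome → ∃ k : ℕ, ∀ n : ℕ, (label (u ++ [n])).isSome ↔ n < k

namespace Tree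

variable {K : ℕ}

/-- The σ-algebra on trees generated by the labels of the individual vertices. -/
instance instMeasurableSpace : MeasurableSpace (Tree K) :=
  ⨆ u : List ℕ, MeasurableSpace.comap (fun T : Tree K => T.label u) ⊤

/-- The set of vertices. -/
def verts (T : Tree K) : Set (List ℕ) := {u | (T.label u).isSome}

/-- The number of vertices of each type (meaningful for trees with finitely many vertices). -/
def typeCount (T : Tree K) (j : Fin K) : ℕ := {u | T.label u = some j}.ncard

end Tree

/-- The label of the vertex `u` in the tree with root of type `i` in which a vertex `v` of type `j`
has offspring word `x (v, j)`. The definition goes through the subtrees of the children of the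
root; `treeLabel_append_singleton` is the description from parent to child. -/
def treeLabel {K : ℕ} : (List ℕ × Fin K → Word K) → Fin K → List ℕ → Option (Fin K)
  | _, i, [] => some i
  | x, i, n :: u => (x ([], i))[n]?.bind fun j => treeLabel (fun p => x (n :: p.1, p.2)) j u

theorem treeLabel_append_singleton {K : ℕ} (u : List ℕ) (n : ℕ) :
    ∀ (x : List ℕ × Fin K → Word K) (i : Fin K),
      treeLabel x i (u ++ [n]) = (treeLabel x i u).bind fun j => (x (u, j))[n]? := by
  induction u with
  | nil => intro x i; simp [treeLabel]
  | cons m u ih =>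
    intro x i
    simp only [List.cons_append, treeLabel]
    cases (x ([], i))[m]? with
    | none => rfl
    | some j => exact ih _ j

theorem treeLabel_ancestor {K : ℕ} (x : List ℕ × Fin K → Word K) (i : Fin K) (u v : List ℕ) :
    (treeLabel x i (u ++ v)).isSome → (treeLabel x i u).isSome := by
  induction v using List.reverseRecOn with
  | nil => simp
  | append_singleton v n ih =>
    intro h
    apply ih
    rw [← List.append_assoc, treeLabel_append_singleton] at h
    cases h' : treeLabel x i (u ++ v) with
    | none => simp [h'] at h
    | some j => rfl

/-- The tree with root of type `i` built from the offspring words `x`. -/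
def buildTree {K : ℕ} (i : Fin K) (x : List ℕ × Fin K → Word K) : Tree K where
  label := treeLabel x i
  root_mem := rfl
  ancestor_mem := treeLabel_ancestor x i
  children := by
    intro u hu
    obtain ⟨j, hj⟩ := Option.isSome_iff_exists.1 hu
    refine ⟨(x (u, j)).length, fun n => ?_⟩
    rw [treeLabel_append_singleton, hj]
    simp

/-- Hence the law of the random tree below is a genuine image measure. -/
theorem measurable_buildTree {K : ℕ} (i : Fin K) : Measurable (buildTree i) := by
  have key : ∀ u : List ℕ, ∀ o : Option (Fin K),
      MeasurableSet {x : List ℕ × Fin K → Word K | treeLabel x i u = o} := by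
    intro u
    induction u using List.reverseRecOn with
    | nil => intro o; simp only [treeLabel]; exact MeasurableSet.const _
    | append_singleton u n ih =>
      intro o
      have : {x : List ℕ × Fin K → Word K | treeLabel x i (u ++ [n]) = o} =
          ({x | treeLabel x i u = none} ∩ {_x | none = o}) ∪
          ⋃ j, ({x | treeLabel x i u = some j} ∩
            (fun x : List ℕ × Fin K → Word K => x (u, j)) ⁻¹' {w | w[n]? = o}) := by
        ext x
        simp only [Set.mem_ofPred_eq, treeLabel_append_singleton, Set.mem_union, Set.mem_inter_iff,
          Set.mem_iUnion, Set.mem_preimage]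
        cases h : treeLabel x i u <;> simp
      rw [this]
      refine ((ih _).inter (MeasurableSet.const _)).union
        (MeasurableSet.iUnion fun j => (ih _).inter ?_)
      exact measurable_pi_apply (u, j) (MeasurableSet.of_discrete)
  rw [measurable_iff_comap_le, Tree.instMeasurableSpace, MeasurableSpace.comap_iSup]
  refine iSup_le fun u => ?_
  rw [MeasurableSpace.comap_comp, ← measurable_iff_comap_le]
  let _ : MeasurableSpace (Option (Fin K)) := ⊤
  exact measurable_to_countable' fun o => key u o

/-! ### Bienaymé–Galton–Watson trees -/

/-- The law of the `ζ`-BGW tree with root of type `i`: the image, under `buildTree i`, of the law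
of independent offspring words `x (u, j)` with respective distributions `ζ j`. -/
def treeLaw {K : ℕ} (ζ : Fin K → PMF (Word K)) (i : Fin K) : MeasureTheory.Measure (Tree K) :=
  (MeasureTheory.Measure.infinitePi fun p : List ℕ × Fin K => (ζ p.2).toMeasure).map (buildTree i)

/-- The BGW tree is finite with positive probability, for every type of the root. -/
def IsFinite {K : ℕ} (μ : Fin K → PMF (Fin K → ℕ)) : Prop :=
  ∃ ζ : Fin K → PMF (Word K), projection ζ = μ ∧
    ∀ i, 0 < treeLaw ζ i {T | T.verts.Finite}

/-- The event that the vector `N` counting the vertices of each type is finite and satisfies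
`Γ N = g`. -/
def sizeEvent {K l : ℕ} (Γ : Matrix (Fin l) (Fin K) ℤ) (g : Fin l → ℤ) : Set (Tree K) :=
  {T | T.verts.Finite ∧ Γ.mulVec (fun j => (T.typeCount j : ℤ)) = g}

/-- The law of the `ζ`-BGW tree with root of type `i` conditioned on `Γ N = g`. -/
def conditionedLaw {K l : ℕ} (ζ : Fin K → PMF (Word K)) (i : Fin K)
    (Γ : Matrix (Fin l) (Fin K) ℤ) (g : Fin l → ℤ) : MeasureTheory.Measure (Tree K) :=
  ProbabilityTheory.cond (treeLaw ζ i) (sizeEvent Γ g)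

end BGW

end

/-!
The proof has two independent halves.

**A critical tilting.** Since `χ(0) = 0`, the relation `θ ∼_Γ 0` holds as soon as `χ(θ)` is a
multiple `t • r` of one nonzero row `r` of `Γ`; no sign of `r` is needed. The Jacobian of `χ` at
`θ` is `M_θ - 1`, where `M_θ` is the mean matrix of the tilted family (`hasDerivAt_chi`), and each
`χ_i` is convex (`convexOn_chi`). Hence `S = {y | ∃ θ, χ θ ≤ y}` is convex and upward closed. If the
line spanned by `r` leaves `S` at the point `y = t • r` with `χ θ ≤ y`, a supporting hyperplane of
`S` at `y` has a normal `c ≥ 0`, and `θ` minimizes `∑ c_i χ_i` (`exists_boundary_point`). So `c` is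
a nonnegative left eigenvector of `M_θ` for the eigenvalue `1`; by irreducibility it is positive,
which makes `M_θ` critical (`spectralRadius_eq_one`) and forces `χ θ = y`
(`exists_critical_tilting`).

That the line does leave `S`, and at an attained point, comes from a coercive combination
`∑ a_i χ_i` with `a ≥ 0` and from a combination `∑ b_i χ_i` that is bounded below and has
`∑ b_i r_i ≠ 0`. Both are found inside the convex cone of the pairs `(x, a)` for which the linear
form `x` is at most `∑ a_i χ_i` up to a constant (`Dominates`). An atom `k` of `μ i` puts
`(k - e_i, e_i)` into it. Adding these pairs over the vertices of a finite tree with root of type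
`i` gives first component `-e_i`; together with irreducibility and nondegeneracy it follows that
every `x` occurs with some `a ≥ 0` (`isDominated_all`). Differences of two atoms then occur with
both signs and the same `a`, and nonlocalization says that they span
(`dominatedSubmodule_eq_top`).

**Conditioned laws.** A finite tree has as its mass the product of the masses of its offspring words
(`treeLaw_singleton`), and every vertex but the root is a child of exactly one vertex
(`sum_count_add_root`). Tilting therefore multiplies the mass of a finite tree with type counts `N`
by `exp (-θ_i - N · χ(θ))` (`treeLaw_wordTilting_singleton`). When `χ(θ) = t • r` for a row `r` of
`Γ`, this factor is constant on the countable event `Γ N = g`, so it cancels in the conditioning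
(`treeLaw_wordTilting`, `conditionedLaw_wordTilting`).
-/

open scoped ENNReal

namespace BGW

variable {K l : ℕ}

/-! ### Exponential tilting -/

theorem tsum_map_mul {α β : Type*} (p : PMF α) (g : α → β) (F : β → ℝ≥0∞) :
    ∑' b, (p.map g) b * F b = ∑' a, p a * F (g a) := by
  classical
  simp_rw [PMF.map_apply, ← ENNReal.tsum_mul_right]
  rw [ENNReal.tsum_comm]
  refine tsum_congr fun a => ?_
  rw [tsum_eq_single (g a)]
  · simp
  · intro b hb
    simp [hb]

theorem tilt_apply {α : Type*} (p : PMF α) (f : α → ℝ) {c : ℝ} (hc : 0 < c)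
    (h : ∑' a, p a * ENNReal.ofReal (Real.exp (f a)) = ENNReal.ofReal c) (a : α) :
    tilt p f a = p a * ENNReal.ofReal (Real.exp (f a - Real.log c)) := by
  have h' : ∑' a, p a * ENNReal.ofReal (Real.exp (f a)) ≠ ∞ := by
    rw [h]; exact ENNReal.ofReal_ne_top
  rw [tilt, dif_pos h', PMF.normalize_apply, h, Real.exp_sub, Real.exp_log hc, div_eq_mul_inv,
    ENNReal.ofReal_mul (Real.exp_pos _).le, ENNReal.ofReal_inv_of_pos hc, mul_assoc]

/-- Tilting commutes with taking image laws, for weights that depend on the image only. -/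
theorem map_tilt {α β : Type*} (p : PMF α) (g : α → β) (f : β → ℝ) {c : ℝ} (hc : 0 < c)
    (h : ∑' b, (p.map g) b * ENNReal.ofReal (Real.exp (f b)) = ENNReal.ofReal c) :
    (tilt p (fun a => f (g a))).map g = tilt (p.map g) f := by
  classical
  have h' := h
  rw [tsum_map_mul p g (fun b => ENNReal.ofReal (Real.exp (f b)))] at h'
  ext b
  rw [tilt_apply _ _ hc h, PMF.map_apply, PMF.map_apply, ← ENNReal.tsum_mul_right]
  refine tsum_congr fun a => ?_
  rw [tilt_apply p _ hc h' a]
  split_ifs with hb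
  · rw [hb]
  · simp

theorem summable_mul_exp {μ : Fin K → PMF (Fin K → ℕ)} (h : IsEntire μ) (i : Fin K)
    (θ : Fin K → ℝ) :
    Summable fun k : Fin K → ℕ => (μ i k).toReal * Real.exp (∑ j, θ j * (k j : ℝ)) := by
  refine (h i (fun j => ((Real.exp (θ j) : ℝ) : ℂ))).norm.congr fun k => ?_
  rw [norm_mul, norm_prod, Complex.norm_real, Real.norm_of_nonneg ENNReal.toReal_nonneg,
    Real.exp_sum]
  congr 1
  refine Finset.prod_congr rfl fun j _ => ?_
  rw [norm_pow, Complex.norm_real, Real.norm_of_nonneg (Real.exp_pos _).le, ← Real.exp_nat_mul,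
    mul_comm]

theorem genFun_exp (μ : Fin K → PMF (Fin K → ℕ)) (i : Fin K) (θ : Fin K → ℝ) :
    genFun μ i (fun j => Real.exp (θ j)) =
      ∑' k : Fin K → ℕ, (μ i k).toReal * Real.exp (∑ j, θ j * (k j : ℝ)) := by
  refine tsum_congr fun k => ?_
  rw [Real.exp_sum]
  congr 1
  refine Finset.prod_congr rfl fun j _ => ?_
  rw [← Real.exp_nat_mul, mul_comm]

theorem toReal_pos_of_mem_support {α : Type*} {p : PMF α} {a : α} (ha : a ∈ p.support) :
    0 < (p a).toReal :=
  ENNReal.toReal_pos ((p.mem_support_iff a).1 ha) (p.apply_ne_top a)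

theorem mul_exp_le_genFun_exp {μ : Fin K → PMF (Fin K → ℕ)} (h : IsEntire μ) (i : Fin K)
    (θ : Fin K → ℝ) (k : Fin K → ℕ) :
    (μ i k).toReal * Real.exp (∑ j, θ j * (k j : ℝ)) ≤ genFun μ i (fun j => Real.exp (θ j)) := by
  rw [genFun_exp]
  exact (summable_mul_exp h i θ).le_tsum k fun _ _ => by positivity

theorem genFun_exp_pos {μ : Fin K → PMF (Fin K → ℕ)} (h : IsEntire μ) (i : Fin K)
    (θ : Fin K → ℝ) : 0 < genFun μ i (fun j => Real.exp (θ j)) := by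
  obtain ⟨k, hk⟩ := (μ i).support_nonempty
  exact lt_of_lt_of_le (mul_pos (toReal_pos_of_mem_support hk) (Real.exp_pos _))
    (mul_exp_le_genFun_exp h i θ k)

theorem tsum_mul_ofReal_exp {μ : Fin K → PMF (Fin K → ℕ)} (h : IsEntire μ) (i : Fin K)
    (θ : Fin K → ℝ) :
    ∑' k : Fin K → ℕ, μ i k * ENNReal.ofReal (Real.exp (∑ j, θ j * (k j : ℝ))) =
      ENNReal.ofReal (genFun μ i (fun j => Real.exp (θ j))) := by
  rw [genFun_exp, ENNReal.ofReal_tsum_of_nonneg (fun _ => by positivity) (summable_mul_exp h i θ)]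
  refine tsum_congr fun k => ?_
  rw [ENNReal.ofReal_mul ENNReal.toReal_nonneg, ENNReal.ofReal_toReal (PMF.apply_ne_top _ _)]

theorem tilting_apply {μ : Fin K → PMF (Fin K → ℕ)} (h : IsEntire μ) (θ : Fin K → ℝ) (i : Fin K)
    (k : Fin K → ℕ) :
    tilting μ θ i k = μ i k * ENNReal.ofReal (Real.exp (∑ j, θ j * (k j : ℝ) -
      Real.log (genFun μ i (fun j => Real.exp (θ j))))) :=
  tilt_apply _ _ (genFun_exp_pos h i θ) (tsum_mul_ofReal_exp h i θ) k

theorem toReal_tilting_apply {μ : Fin K → PMF (Fin K → ℕ)} (h : IsEntire μ) (θ : Fin K → ℝ)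
    (i : Fin K) (k : Fin K → ℕ) :
    (tilting μ θ i k).toReal = (μ i k).toReal * Real.exp (∑ j, θ j * (k j : ℝ)) /
      genFun μ i (fun j => Real.exp (θ j)) := by
  rw [tilting_apply h, ENNReal.toReal_mul, ENNReal.toReal_ofReal (Real.exp_pos _).le, Real.exp_sub,
    Real.exp_log (genFun_exp_pos h i θ), mul_div_assoc]

theorem wordTilting_apply {μ : Fin K → PMF (Fin K → ℕ)} (h : IsEntire μ)
    {ζ : Fin K → PMF (Word K)} (hζ : projection ζ = μ) (θ : Fin K → ℝ) (i : Fin K) (w : Word K) :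
    wordTilting ζ θ i w = ζ i w * ENNReal.ofReal (Real.exp (∑ j, θ j * (w.count j : ℝ) -
      Real.log (genFun μ i (fun j => Real.exp (θ j))))) := by
  have hs := tsum_mul_ofReal_exp h i θ
  rw [← hζ] at hs ⊢
  rw [projection, tsum_map_mul (ζ i) (fun w j => w.count j)
    (fun k => ENNReal.ofReal (Real.exp (∑ j, θ j * (k j : ℝ))))] at hs
  rw [← hζ] at h
  exact tilt_apply _ _ (genFun_exp_pos h i θ) hs w

theorem projection_wordTilting {μ : Fin K → PMF (Fin K → ℕ)} (h : IsEntire μ)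
    {ζ : Fin K → PMF (Word K)} (hζ : projection ζ = μ) (θ : Fin K → ℝ) :
    projection (wordTilting ζ θ) = tilting μ θ := by
  subst hζ
  funext i
  exact map_tilt (ζ i) (fun w j => w.count j) (fun k => ∑ j, θ j * (k j : ℝ))
    (genFun_exp_pos h i θ) (tsum_mul_ofReal_exp h i θ)

theorem isEntire_tilting {μ : Fin K → PMF (Fin K → ℕ)} (h : IsEntire μ) (θ : Fin K → ℝ) :
    IsEntire (tilting μ θ) := by
  intro i z
  refine ((h i (fun j => ((Real.exp (θ j) : ℝ) : ℂ) * z j)).mul_left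
    ((genFun μ i (fun j => Real.exp (θ j)) : ℝ) : ℂ)⁻¹).congr fun k => ?_
  rw [toReal_tilting_apply h, Real.exp_sum]
  push_cast
  simp_rw [mul_pow]
  rw [Finset.prod_mul_distrib]
  have : ∀ j, Complex.exp (θ j) ^ k j = Complex.exp ((θ j : ℂ) * (k j : ℂ)) := fun j => by
    rw [← Complex.exp_nat_mul, mul_comm]
  simp_rw [this]
  ring

/-! ### Convexity and gradient of `χ` -/

theorem chi_zero (μ : Fin K → PMF (Fin K → ℕ)) : chi μ 0 = 0 := by
  funext i
  have : genFun μ i (fun j => Real.exp ((0 : Fin K → ℝ) j)) = 1 := by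
    rw [genFun_exp]
    simp only [Pi.zero_apply, zero_mul, Finset.sum_const_zero, Real.exp_zero, mul_one]
    rw [← ENNReal.tsum_toReal_eq fun k => PMF.apply_ne_top _ _, PMF.tsum_coe, ENNReal.toReal_one]
  rw [chi, this]
  simp

/-- Each atom `k` of the `i`-th distribution gives an affine minorant of `χ_i`, with gradient
`k - e_i`. -/
theorem le_chi {μ : Fin K → PMF (Fin K → ℕ)} (h : IsEntire μ) {i : Fin K} {k : Fin K → ℕ}
    (hk : k ∈ (μ i).support) (θ : Fin K → ℝ) :
    Real.log (μ i k).toReal + ∑ j, θ j * (k j : ℝ) - θ i ≤ chi μ θ i := by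
  rw [chi]
  refine sub_le_sub_right ?_ _
  rw [← Real.log_exp (∑ j, θ j * (k j : ℝ)),
    ← Real.log_mul (toReal_pos_of_mem_support hk).ne' (Real.exp_pos _).ne']
  exact Real.log_le_log (mul_pos (toReal_pos_of_mem_support hk) (Real.exp_pos _))
    (mul_exp_le_genFun_exp h i θ k)

theorem convexOn_chi {μ : Fin K → PMF (Fin K → ℕ)} (h : IsEntire μ) (i : Fin K) :
    ConvexOn ℝ Set.univ (fun θ => chi μ θ i) := by
  refine ⟨convex_univ, fun x _ y _ s t hs ht hst => ?_⟩
  set Z : (Fin K → ℝ) → ℝ := fun θ => genFun μ i (fun j => Real.exp (θ j)) with hZ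
  have hpos : ∀ θ, 0 < Z θ := fun θ => genFun_exp_pos h i θ
  have hsum : ∀ θ, HasSum (fun k : Fin K → ℕ => (μ i k).toReal *
      Real.exp (∑ j, θ j * (k j : ℝ) - Real.log (Z θ))) 1 := by
    intro θ
    have := (summable_mul_exp h i θ).hasSum.div_const (Z θ)
    rw [← genFun_exp, div_self (hpos θ).ne'] at this
    refine this.congr_fun fun k => ?_
    rw [Real.exp_sub, Real.exp_log (hpos θ), mul_div_assoc]
  -- The exponential is convex, and the tilted weights at `x` and at `y` have total mass one.
  have key : Z (s • x + t • y) ≤ Real.exp (s * Real.log (Z x) + t * Real.log (Z y)) := by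
    have h1 := (summable_mul_exp h i (s • x + t • y)).hasSum.mul_right
      (Real.exp (-(s * Real.log (Z x) + t * Real.log (Z y))))
    rw [← genFun_exp] at h1
    have h2 := hasSum_le (fun k => ?_) h1 (((hsum x).mul_left s).add ((hsum y).mul_left t))
    · rw [mul_one, mul_one, hst, Real.exp_neg, ← div_eq_mul_inv, div_le_one (Real.exp_pos _)] at h2
      exact h2
    · have := convexOn_exp.2 (Set.mem_univ (∑ j, x j * (k j : ℝ) - Real.log (Z x)))
        (Set.mem_univ (∑ j, y j * (k j : ℝ) - Real.log (Z y))) hs ht hst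
      simp only [smul_eq_mul] at this
      have e : s * (∑ j, x j * (k j : ℝ) - Real.log (Z x)) +
          t * (∑ j, y j * (k j : ℝ) - Real.log (Z y)) =
          ∑ j, (s • x + t • y) j * (k j : ℝ) +
            -(s * Real.log (Z x) + t * Real.log (Z y)) := by
        simp only [Pi.add_apply, Pi.smul_apply, smul_eq_mul, add_mul, Finset.sum_add_distrib,
          mul_assoc, ← Finset.mul_sum]
        ring
      rw [e, Real.exp_add] at this
      calc _ = (μ i k).toReal * (Real.exp (∑ j, (s • x + t • y) j * (k j : ℝ)) *
            Real.exp (-(s * Real.log (Z x) + t * Real.log (Z y)))) := by ring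
        _ ≤ _ := mul_le_mul_of_nonneg_left this ENNReal.toReal_nonneg
        _ = _ := by ring
  have := Real.log_le_log (hpos _) key
  rw [Real.log_exp] at this
  simp only [chi, Pi.add_apply, Pi.smul_apply, smul_eq_mul]
  change Real.log (Z (s • x + t • y)) - _ ≤ s * (Real.log (Z x) - _) + t * (Real.log (Z y) - _)
  linarith

theorem continuous_chi {μ : Fin K → PMF (Fin K → ℕ)} (h : IsEntire μ) (i : Fin K) :
    Continuous (fun θ => chi μ θ i) :=
  continuousOn_univ.1 ((convexOn_chi h i).continuousOn isOpen_univ)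

theorem integrableExpSet_eq_univ {μ : Fin K → PMF (Fin K → ℕ)} (h : IsEntire μ) (i j : Fin K) :
    ProbabilityTheory.integrableExpSet (fun k : Fin K → ℕ => (k j : ℝ)) (μ i).toMeasure =
      Set.univ := by
  refine Set.eq_univ_of_forall fun t => ?_
  rw [ProbabilityTheory.integrableExpSet, Set.mem_ofPred_eq]
  have hm : MeasureTheory.AEStronglyMeasurable (fun k : Fin K → ℕ => Real.exp (t * (k j : ℝ)))
      (μ i).toMeasure := (measurable_of_countable _).aestronglyMeasurable
  refine ⟨hm, ?_⟩
  rw [MeasureTheory.hasFiniteIntegral_iff_ofReal (Filter.Eventually.of_forall fun _ => by positivity),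
    MeasureTheory.lintegral_countable']
  have hs := tsum_mul_ofReal_exp h i (Pi.single j t)
  have : ∀ k : Fin K → ℕ, ∑ j', (Pi.single j t : Fin K → ℝ) j' * (k j' : ℝ) = t * (k j : ℝ) := by
    intro k
    rw [Finset.sum_eq_single j] <;> simp +contextual
  simp_rw [this] at hs
  simp_rw [PMF.toMeasure_apply_singleton _ _ (measurableSet_singleton _), mul_comm _ (μ i _), hs]
  exact ENNReal.ofReal_lt_top

theorem integrable_coord {μ : Fin K → PMF (Fin K → ℕ)} (h : IsEntire μ) (i j : Fin K) :
    MeasureTheory.Integrable (fun k : Fin K → ℕ => (k j : ℝ)) (μ i).toMeasure :=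
  ProbabilityTheory.integrable_of_mem_interior_integrableExpSet
    (by simp [integrableExpSet_eq_univ h])

theorem meanMatrix_eq_integral {μ : Fin K → PMF (Fin K → ℕ)} (h : IsEntire μ) (i j : Fin K) :
    meanMatrix μ i j = ∫ k, (k j : ℝ) ∂(μ i).toMeasure := by
  rw [PMF.integral_eq_tsum _ _ (integrable_coord h i j)]
  simp [meanMatrix, mul_comm]

theorem genFun_eq_mgf {μ : Fin K → PMF (Fin K → ℕ)} (h : IsEntire μ) (i j : Fin K) (t : ℝ) :
    genFun μ i (fun j' => Real.exp ((Pi.single j t : Fin K → ℝ) j')) =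
      ProbabilityTheory.mgf (fun k : Fin K → ℕ => (k j : ℝ)) (μ i).toMeasure t := by
  have hI : t ∈ ProbabilityTheory.integrableExpSet (fun k : Fin K → ℕ => (k j : ℝ))
    (μ i).toMeasure := by rw [integrableExpSet_eq_univ h]; trivial
  rw [ProbabilityTheory.mgf, PMF.integral_eq_tsum _ _ hI, genFun_exp]
  refine tsum_congr fun k => ?_
  rw [Finset.sum_eq_single j] <;> simp +contextual

theorem genFun_tilting {μ : Fin K → PMF (Fin K → ℕ)} (h : IsEntire μ) (i : Fin K)
    (θ η : Fin K → ℝ) :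
    genFun (tilting μ θ) i (fun j => Real.exp (η j)) =
      genFun μ i (fun j => Real.exp ((θ + η) j)) / genFun μ i (fun j => Real.exp (θ j)) := by
  rw [genFun_exp, genFun_exp μ i (θ + η), ← tsum_div_const]
  refine tsum_congr fun k => ?_
  rw [toReal_tilting_apply h]
  simp only [Pi.add_apply, add_mul, Finset.sum_add_distrib, Real.exp_add]
  ring

/-- The Jacobian of `χ` at `θ` is `M_θ - 1`, where `M_θ` is the mean matrix of the family tilted
by `θ`. -/
theorem hasDerivAt_chi {μ : Fin K → PMF (Fin K → ℕ)} (h : IsEntire μ) (θ : Fin K → ℝ)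
    (i j : Fin K) :
    HasDerivAt (fun t : ℝ => chi μ (θ + Pi.single j t) i)
      (meanMatrix (tilting μ θ) i j - (1 : Matrix (Fin K) (Fin K) ℝ) i j) 0 := by
  have hν := isEntire_tilting h θ
  set ν := tilting μ θ with hνdef
  have h0 : (0 : ℝ) ∈ interior (ProbabilityTheory.integrableExpSet
      (fun k : Fin K → ℕ => (k j : ℝ)) (ν i).toMeasure) := by
    simp [integrableExpSet_eq_univ hν]
  have hm := ProbabilityTheory.hasDerivAt_mgf h0
  have hl := hm.log (by simp)
  simp only [zero_mul, Real.exp_zero, mul_one, ProbabilityTheory.mgf_zero, div_one,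
    ← meanMatrix_eq_integral hν] at hl
  have hlin : HasDerivAt (fun t : ℝ => (Pi.single j t : Fin K → ℝ) i)
      ((1 : Matrix (Fin K) (Fin K) ℝ) i j) 0 := by
    by_cases hij : i = j
    · subst hij
      simpa using hasDerivAt_id' (0 : ℝ)
    · simpa [Pi.single_apply, hij, Matrix.one_apply] using hasDerivAt_const (0 : ℝ) (0 : ℝ)
  have := (hl.sub hlin).add_const (Real.log (genFun μ i (fun j => Real.exp (θ j))) - θ i)
  refine this.congr_of_eventuallyEq (Filter.Eventually.of_forall fun t => ?_)
  simp only [Pi.sub_apply]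
  rw [← genFun_eq_mgf hν, genFun_tilting h,
    Real.log_div (genFun_exp_pos h i _).ne' (genFun_exp_pos h i _).ne']
  simp only [chi, Pi.add_apply]
  ring

/-! ### A convex minimization problem -/

/-- If `y` lies strictly above no value of `χ`, then `{z | ∃ θ, χ θ < z}`, with all coordinates
strictly smaller, has a supporting hyperplane at `y`; its normal is nonnegative because this set is
upward closed. -/
theorem exists_multiplier {χ : (Fin K → ℝ) → Fin K → ℝ}
    (hconv : ∀ i, ConvexOn ℝ Set.univ (fun θ => χ θ i)) {y : Fin K → ℝ}
    (hy : ¬ ∃ θ, ∀ i, χ θ i < y i) :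
    ∃ c : Fin K → ℝ, 0 ≤ c ∧ c ≠ 0 ∧ ∀ θ, ∑ i, c i * y i ≤ ∑ i, c i * χ θ i := by
  set S : Set (Fin K → ℝ) := {z | ∃ θ, ∀ i, χ θ i < z i} with hS
  have hSc : Convex ℝ S := by
    rintro x ⟨θ, hθ⟩ z ⟨η, hη⟩ s t hs ht hst
    refine ⟨s • θ + t • η, fun i => ?_⟩
    refine lt_of_le_of_lt ((hconv i).2 trivial trivial hs ht hst) ?_
    simp only [Pi.add_apply, Pi.smul_apply, smul_eq_mul]
    rcases hs.eq_or_lt with rfl | hs'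
    · rw [zero_add] at hst
      subst hst
      simpa using hη i
    · exact add_lt_add_of_lt_of_le (mul_lt_mul_of_pos_left (hθ i) hs')
        (mul_le_mul_of_nonneg_left (hη i).le ht)
  have hSo : IsOpen S := by
    have : S = ⋃ θ, Set.pi Set.univ (fun i => Set.Ioi (χ θ i)) := by
      ext z; simp [hS]
    rw [this]
    exact isOpen_iUnion fun θ => isOpen_set_pi Set.finite_univ fun i _ => isOpen_Ioi
  obtain ⟨f, hf⟩ := geometric_hahn_banach_open_point hSc hSo hy
  have hfs : ∀ z : Fin K → ℝ, f z = ∑ i, z i * f (Pi.single i 1) := by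
    intro z
    conv_lhs => rw [← Finset.univ_sum_single z]
    rw [map_sum]
    refine Finset.sum_congr rfl fun i _ => ?_
    rw [← smul_eq_mul, ← map_smul]
    congr 1
    ext j
    by_cases hij : j = i
    · subst hij; simp
    · simp [hij]
  have hneg : ∀ i, f (Pi.single i 1) ≤ 0 := by
    intro i
    by_contra! hpos
    set z : Fin K → ℝ := fun j => χ 0 j + 1 with hz
    obtain ⟨n, hn⟩ := exists_nat_gt ((f y - f z) / f (Pi.single i 1))
    rw [div_lt_iff₀ hpos] at hn
    have := hf (z + (n : ℝ) • Pi.single i 1) ⟨0, fun j => ?_⟩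
    · rw [map_add, map_smul, smul_eq_mul] at this
      linarith
    · have : 0 ≤ (n : ℝ) * (Pi.single i 1 : Fin K → ℝ) j :=
        mul_nonneg (Nat.cast_nonneg n) (by by_cases hij : j = i <;> simp [hij])
      simp only [hz, Pi.add_apply, Pi.smul_apply, smul_eq_mul]
      linarith
  refine ⟨fun i => -f (Pi.single i 1), fun i => ?_, fun h0 => ?_, fun θ => ?_⟩
  · simpa using hneg i
  · have h0' : ∀ z, f z = 0 := fun z => by
      rw [hfs]
      refine Finset.sum_eq_zero fun i _ => ?_
      have := congrFun h0 i
      simp only [Pi.zero_apply, neg_eq_zero] at this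
      rw [this, mul_zero]
    have := hf (fun j => χ 0 j + 1) ⟨0, fun j => by simp⟩
    rw [h0', h0'] at this
    exact lt_irrefl _ this
  · have hle : f (χ θ) ≤ f y := by
      have hlim : Filter.Tendsto (fun s : ℝ => f (χ θ + s • fun _ => 1)) (nhdsWithin 0 (Set.Ioi 0))
          (nhds (f (χ θ))) := by
        have hc : Continuous fun s : ℝ => f (χ θ + s • fun _ => 1) := by fun_prop
        have := hc.tendsto 0
        simp only [zero_smul, add_zero] at this
        exact this.mono_left nhdsWithin_le_nhds
      refine le_of_tendsto hlim ?_
      filter_upwards [self_mem_nhdsWithin] with s hs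
      exact (hf _ ⟨θ, fun i => by simpa using hs⟩).le
    rw [hfs, hfs] at hle
    simp only [neg_mul, Finset.sum_neg_distrib, neg_le_neg_iff]
    simpa only [mul_comm] using hle

/-- Among the `(t, θ)` with `χ θ ≤ t • r` there is one with the least `t`, as soon as some
nonnegative combination of the `χ_i` is coercive and another one, `∑ b_i χ_i` with
`∑ b_i r_i > 0`, is bounded below. -/
theorem exists_minimal {χ : (Fin K → ℝ) → Fin K → ℝ}
    (hcont : ∀ i, Continuous (fun θ => χ θ i)) (h0 : χ 0 = 0) {a b r : Fin K → ℝ} {C D : ℝ}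
    (ha : 0 ≤ a) (hb : 0 ≤ b) (hcoer : ∀ θ j, |θ j| ≤ ∑ i, a i * χ θ i + C)
    (hbdd : ∀ θ, -D ≤ ∑ i, b i * χ θ i) (hbr : 0 < ∑ i, b i * r i) :
    ∃ (t : ℝ) (θ : Fin K → ℝ), (∀ i, χ θ i ≤ t * r i) ∧
      ∀ s, s < t → ¬ ∃ η, ∀ i, χ η i ≤ s * r i := by
  set S : Set (ℝ × (Fin K → ℝ)) := {p | p.1 ≤ 0 ∧ ∀ i, χ p.2 i ≤ p.1 * r i} with hS
  have hsum : ∀ (e : Fin K → ℝ), 0 ≤ e → ∀ p ∈ S,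
      ∑ i, e i * χ p.2 i ≤ p.1 * ∑ i, e i * r i := by
    intro e he p hp
    rw [Finset.mul_sum]
    refine Finset.sum_le_sum fun i _ => ?_
    have := mul_le_mul_of_nonneg_left (hp.2 i) (he i)
    linarith
  set lo : ℝ := -D / ∑ i, b i * r i with hlo
  have hlow : ∀ p ∈ S, lo ≤ p.1 := fun p hp => by
    rw [hlo, div_le_iff₀ hbr]
    exact (hbdd p.2).trans (hsum b hb p hp)
  set B : ℝ := |lo| * |∑ i, a i * r i| + C with hB
  have hbox : ∀ p ∈ S, ∀ j, |p.2 j| ≤ B := fun p hp j => by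
    refine (hcoer p.2 j).trans (add_le_add_left ((hsum a ha p hp).trans ?_) C)
    refine (le_abs_self _).trans ?_
    rw [abs_mul]
    refine mul_le_mul_of_nonneg_right ?_ (abs_nonneg _)
    rw [abs_of_nonpos hp.1, abs_of_nonpos ((hlow p hp).trans hp.1)]
    exact neg_le_neg (hlow p hp)
  have hclosed : IsClosed S := by
    have : S = {p : ℝ × (Fin K → ℝ) | p.1 ≤ 0} ∩
        ⋂ i, {p : ℝ × (Fin K → ℝ) | χ p.2 i ≤ p.1 * r i} := by
      ext p; simp [hS]
    rw [this]
    refine (isClosed_le continuous_fst continuous_const).inter (isClosed_iInter fun i => ?_)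
    exact isClosed_le ((hcont i).comp continuous_snd) (continuous_fst.mul continuous_const)
  have hcompact : IsCompact S := by
    refine (isCompact_Icc (a := ((lo, fun _ => -B) : ℝ × (Fin K → ℝ)))
      (b := (0, fun _ => B))).of_isClosed_subset hclosed fun p hp => ?_
    exact ⟨⟨hlow p hp, fun j => (abs_le.1 (hbox p hp j)).1⟩,
      ⟨hp.1, fun j => (abs_le.1 (hbox p hp j)).2⟩⟩
  obtain ⟨p, hp, hmin⟩ := hcompact.exists_isMinOn ⟨(0, 0), by simp [hS, h0]⟩
    continuous_fst.continuousOn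
  refine ⟨p.1, p.2, hp.2, fun s hs => ?_⟩
  rintro ⟨η, hη⟩
  exact absurd (hmin (show (s, η) ∈ S from ⟨hs.le.trans hp.1, hη⟩)) (not_le.2 hs)

/-- On every line through the origin whose direction is not orthogonal to some `b ≥ 0` with
`∑ b_i χ_i` bounded below, the set `{y | ∃ θ, χ θ ≤ y}` has a boundary point `t • r`, attained in
the sense that `χ θ ≤ t • r` for some `θ`, and a supporting hyperplane there with normal `c ≥ 0`. -/
theorem exists_boundary_point {χ : (Fin K → ℝ) → Fin K → ℝ}
    (hconv : ∀ i, ConvexOn ℝ Set.univ (fun θ => χ θ i))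
    (hcont : ∀ i, Continuous (fun θ => χ θ i)) (h0 : χ 0 = 0) {a b r : Fin K → ℝ} {C D : ℝ}
    (ha : 0 ≤ a) (hb : 0 ≤ b) (hcoer : ∀ θ j, |θ j| ≤ ∑ i, a i * χ θ i + C)
    (hbdd : ∀ θ, -D ≤ ∑ i, b i * χ θ i) (hbr : ∑ i, b i * r i ≠ 0) :
    ∃ (t : ℝ) (θ c : Fin K → ℝ), (∀ i, χ θ i ≤ t * r i) ∧ 0 ≤ c ∧ c ≠ 0 ∧
      ∀ η, ∑ i, c i * (t * r i) ≤ ∑ i, c i * χ η i := by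
  wlog hpos : 0 < ∑ i, b i * r i generalizing r
  · have hneg : ∑ i, b i * (-r) i = -∑ i, b i * r i := by simp
    obtain ⟨t, θ, c, h1, h2, h3, h4⟩ := this (r := -r) (by rw [hneg]; exact neg_ne_zero.2 hbr)
      (by rw [hneg]; exact neg_pos.2 (lt_of_le_of_ne (not_lt.1 hpos) hbr))
    refine ⟨-t, θ, c, fun i => ?_, h2, h3, fun η => ?_⟩
    · simpa using h1 i
    · simpa using h4 η
  obtain ⟨t, θ, hθ, hmin⟩ := exists_minimal hcont h0 ha hb hcoer hbdd hpos
  obtain ⟨c, hc0, hcne, hc⟩ := exists_multiplier hconv (y := fun i => t * r i) (by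
    rintro ⟨η, hη⟩
    -- A strict inequality would persist for a slightly smaller `t`.
    have hev : ∀ i, ∀ᶠ s in nhdsWithin t (Set.Iio t), χ η i < s * r i := fun i => by
      have hc : Continuous fun s : ℝ => s * r i := by fun_prop
      exact (hc.tendsto t).mono_left nhdsWithin_le_nhds |>.eventually_const_lt (hη i)
    obtain ⟨s, hs, hst⟩ := ((Filter.eventually_all.2 hev).and self_mem_nhdsWithin).exists
    exact hmin s hst ⟨η, fun i => (hs i).le⟩)
  exact ⟨t, θ, c, hθ, hc0, hcne, hc⟩

/-! ### Spectral radius -/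

/-- A nonnegative matrix with a positive left eigenvector for the eigenvalue `1` has spectral
radius `1`. -/
theorem spectralRadius_eq_one {M : Matrix (Fin K) (Fin K) ℝ} (hM : ∀ i j, 0 ≤ M i j)
    {c : Fin K → ℝ} (hc : ∀ i, 0 < c i) (hcM : ∀ j, ∑ i, c i * M i j = c j) (i₀ : Fin K) :
    spectralRadius ℂ (M.map (fun x : ℝ => (x : ℂ))) = 1 := by
  apply le_antisymm
  · refine iSup₂_le fun z hz => ?_
    rw [spectrum.mem_iff, Matrix.isUnit_iff_isUnit_det, isUnit_iff_ne_zero, not_not,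
      ← Matrix.exists_mulVec_eq_zero_iff] at hz
    obtain ⟨v, hv, hzv⟩ := hz
    have hev : ∀ i, z * v i = ∑ j, (M i j : ℂ) * v j := by
      intro i
      have := congrFun hzv i
      rw [Matrix.sub_mulVec, Pi.sub_apply, Pi.zero_apply, sub_eq_zero, Algebra.algebraMap_eq_smul_one,
        Matrix.smul_mulVec, Matrix.one_mulVec] at this
      simpa [Matrix.mulVec, dotProduct] using this
    have h1 : ‖z‖ * ∑ i, c i * ‖v i‖ ≤ ∑ i, c i * ‖v i‖ := by
      calc ‖z‖ * ∑ i, c i * ‖v i‖ = ∑ i, c i * ‖z * v i‖ := by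
            rw [Finset.mul_sum]
            exact Finset.sum_congr rfl fun i _ => by rw [norm_mul]; ring
        _ ≤ ∑ i, c i * ∑ j, M i j * ‖v j‖ := by
            refine Finset.sum_le_sum fun i _ => mul_le_mul_of_nonneg_left ?_ (hc i).le
            rw [hev]
            refine (norm_sum_le _ _).trans (Finset.sum_le_sum fun j _ => ?_)
            rw [norm_mul, Complex.norm_real, Real.norm_of_nonneg (hM i j)]
        _ = ∑ j, (∑ i, c i * M i j) * ‖v j‖ := by
            simp_rw [Finset.mul_sum, Finset.sum_mul]
            rw [Finset.sum_comm]
            exact Finset.sum_congr rfl fun _ _ => Finset.sum_congr rfl fun _ _ => by ring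
        _ = ∑ i, c i * ‖v i‖ := by simp_rw [hcM]
    obtain ⟨i, hi⟩ := Function.ne_iff.1 hv
    have hpos : 0 < ∑ i, c i * ‖v i‖ :=
      Finset.sum_pos' (fun i _ => mul_nonneg (hc i).le (norm_nonneg _))
        ⟨i, Finset.mem_univ i, mul_pos (hc i) (norm_pos_iff.2 hi)⟩
    have h2 : ‖z‖ ≤ 1 := by
      by_contra! h
      nlinarith
    exact_mod_cast h2
  · have hmem : (1 : ℂ) ∈ spectrum ℂ (M.map (fun x : ℝ => (x : ℂ))) := by
      rw [spectrum.mem_iff, Matrix.isUnit_iff_isUnit_det, isUnit_iff_ne_zero, not_not,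
        ← Matrix.exists_vecMul_eq_zero_iff]
      refine ⟨fun i => (c i : ℂ), fun h => ?_, ?_⟩
      · exact (hc i₀).ne' (by simpa using congrFun h i₀)
      · rw [map_one, Matrix.vecMul_sub, Matrix.vecMul_one, sub_eq_zero]
        funext j
        simp only [Matrix.vecMul, dotProduct, Matrix.map_apply]
        rw [← hcM j]
        push_cast
        rfl
    refine le_trans ?_ (le_iSup₂ (f := fun (k : ℂ) (_ : k ∈ spectrum ℂ
      (M.map (fun x : ℝ => (x : ℂ)))) => (‖k‖₊ : ℝ≥0∞)) 1 hmem)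
    simp

/-! ### Irreducibility -/

/-- The type `j` occurs with positive probability among the children of a vertex of type `i`. -/
def IsChildType (μ : Fin K → PMF (Fin K → ℕ)) (i j : Fin K) : Prop :=
  ∃ k ∈ (μ i).support, 0 < k j

theorem meanMatrix_nonneg (μ : Fin K → PMF (Fin K → ℕ)) (i j : Fin K) : 0 ≤ meanMatrix μ i j :=
  tsum_nonneg fun _ => by positivity

theorem IsChildType.of_meanMatrix_pos {μ : Fin K → PMF (Fin K → ℕ)} {i j : Fin K}
    (h : 0 < meanMatrix μ i j) : IsChildType μ i j := by
  by_contra hn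
  simp only [IsChildType, not_exists, not_and, not_lt, nonpos_iff_eq_zero] at hn
  refine h.ne' ((tsum_congr fun z => ?_).trans tsum_zero)
  by_cases hz : z ∈ (μ i).support
  · simp [hn z hz]
  · simp [(PMF.apply_eq_zero_iff _ _).2 hz]

theorem IsChildType.meanMatrix_tilting_pos {μ : Fin K → PMF (Fin K → ℕ)} (h : IsEntire μ)
    {i j : Fin K} (hij : IsChildType μ i j) (θ : Fin K → ℝ) :
    0 < meanMatrix (tilting μ θ) i j := by
  obtain ⟨k, hk, hkj⟩ := hij
  have hs : Summable fun z : Fin K → ℕ => (z j : ℝ) * (tilting μ θ i z).toReal := by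
    refine Summable.of_nonneg_of_le (fun _ => by positivity) (fun z => ?_)
      (summable_mul_exp (isEntire_tilting h θ) i (Pi.single j 1))
    rw [mul_comm, Finset.sum_eq_single j (by simp +contextual) (by simp), Pi.single_eq_same,
      one_mul]
    exact mul_le_mul_of_nonneg_left (by linarith [Real.add_one_le_exp (z j : ℝ)])
      ENNReal.toReal_nonneg
  refine hs.tsum_pos (fun _ => by positivity) k (mul_pos (by exact_mod_cast hkj) ?_)
  rw [toReal_tilting_apply h]
  exact div_pos (mul_pos (toReal_pos_of_mem_support hk) (Real.exp_pos _)) (genFun_exp_pos h _ _)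

theorem IsIrreducible.reflTransGen {μ : Fin K → PMF (Fin K → ℕ)} (h : IsIrreducible μ)
    (i j : Fin K) : Relation.ReflTransGen (IsChildType μ) i j := by
  obtain ⟨p, -, hp⟩ := h i j
  induction p generalizing i with
  | zero =>
    by_cases hij : i = j
    · rw [hij]
    · simp [hij] at hp
  | succ p ih =>
    rw [pow_succ', Matrix.mul_apply] at hp
    have hnn : ∀ (q : ℕ) (a b : Fin K), 0 ≤ (meanMatrix μ ^ q) a b := by
      intro q
      induction q with
      | zero => intro a b; by_cases hab : a = b <;> simp [hab]
      | succ q ihq =>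
        intro a b
        rw [pow_succ, Matrix.mul_apply]
        exact Finset.sum_nonneg fun m _ => mul_nonneg (ihq a m) (meanMatrix_nonneg μ m b)
    obtain ⟨m, -, hm⟩ := Finset.exists_lt_of_sum_lt (s := Finset.univ) (f := fun _ => (0 : ℝ))
      (g := fun m => meanMatrix μ i m * (meanMatrix μ ^ p) m j) (by simpa using hp)
    have h1 : 0 < meanMatrix μ i m := by
      refine lt_of_le_of_ne (meanMatrix_nonneg μ i m) fun h => ?_
      rw [← h, zero_mul] at hm
      exact lt_irrefl _ hm
    exact .head (.of_meanMatrix_pos h1) (ih m ((mul_pos_iff_of_pos_left h1).1 hm))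

/-! ### Finite trees -/

namespace Tree

/-- The vertices of a tree paired with their types. -/
def typedVerts (T : Tree K) : Set (List ℕ × Fin K) := {p | T.label p.1 = some p.2}

theorem finite_typedVerts {T : Tree K} (h : T.verts.Finite) : T.typedVerts.Finite := by
  refine (h.prod (Set.finite_univ (α := Fin K))).subset fun p hp => ⟨?_, trivial⟩
  change (T.label p.1).isSome
  rw [show T.label p.1 = some p.2 from hp]
  rfl

theorem typedVerts_injective : Function.Injective (typedVerts (K := K)) := by
  intro T T' h
  refine Tree.ext (funext fun u => Option.ext fun j => ?_)
  exact Set.ext_iff.1 h (u, j)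

theorem countable_finite : {T : Tree K | T.verts.Finite}.Countable := by
  have : {s : Set (List ℕ × Fin K) | s.Finite}.Countable :=
    (Set.countable_ofPred_finite_subset (Set.to_countable Set.univ)).mono
      fun s hs => And.intro hs (Set.subset_univ s)
  exact (this.preimage_of_injOn typedVerts_injective.injOn).mono fun T hT => finite_typedVerts hT

instance : MeasurableSingletonClass (Tree K) where
  measurableSet_singleton T := by
    have : ({T} : Set (Tree K)) = ⋂ u : List ℕ, {T' | T'.label u = T.label u} := by
      ext T'
      simp only [Set.mem_singleton_iff, Set.mem_iInter, Set.mem_ofPred_eq]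
      exact ⟨fun h u => by rw [h], fun h => Tree.ext (funext h)⟩
    rw [this]
    refine MeasurableSet.iInter fun u => ?_
    have hle : MeasurableSpace.comap (fun T : Tree K => T.label u) ⊤ ≤
        (instMeasurableSpace : MeasurableSpace (Tree K)) :=
      le_iSup (fun u : List ℕ => MeasurableSpace.comap (fun T : Tree K => T.label u) ⊤) u
    exact hle _ ⟨{o | o = T.label u}, trivial, rfl⟩

end Tree

theorem buildTree_eq_iff (i : Fin K) (x y : List ℕ × Fin K → Word K) :
    buildTree i x = buildTree i y ↔ ∀ p ∈ (buildTree i y).typedVerts, x p = y p := by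
  constructor
  · rintro h ⟨u, j⟩ hp
    have hlab : ∀ v, treeLabel x i v = treeLabel y i v := fun v => congrFun (congrArg Tree.label h) v
    have hu : treeLabel y i u = some j := hp
    refine List.ext_getElem? fun n => ?_
    have := hlab (u ++ [n])
    rwa [treeLabel_append_singleton, treeLabel_append_singleton, hlab, hu] at this
  · intro h
    refine Tree.ext (funext fun u => ?_)
    change treeLabel x i u = treeLabel y i u
    induction u using List.reverseRecOn with
    | nil => rfl
    | append_singleton u n ih =>
      rw [treeLabel_append_singleton, treeLabel_append_singleton, ih]
      cases hu : treeLabel y i u with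
      | none => rfl
      | some j => simp only [Option.bind_some, h (u, j) hu]

/-- The mass of a finite tree is the product of the masses of its offspring words. -/
theorem treeLaw_singleton (ζ : Fin K → PMF (Word K)) (i : Fin K) (x : List ℕ × Fin K → Word K)
    {F : Finset (List ℕ × Fin K)} (hF : (F : Set (List ℕ × Fin K)) = (buildTree i x).typedVerts) :
    treeLaw ζ i {buildTree i x} = ∏ p ∈ F, ζ p.2 (x p) := by
  have : buildTree i ⁻¹' {buildTree i x} = Set.pi (F : Set (List ℕ × Fin K)) fun p => {x p} := by
    ext y
    rw [Set.mem_preimage, Set.mem_singleton_iff, buildTree_eq_iff, hF]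
    rfl
  rw [treeLaw, MeasureTheory.Measure.map_apply (measurable_buildTree i) (measurableSet_singleton _),
    this, MeasureTheory.Measure.infinitePi_pi _ (fun _ _ => measurableSet_singleton _)]
  exact Finset.prod_congr rfl fun p _ =>
    PMF.toMeasure_apply_singleton _ _ (measurableSet_singleton _)

theorem treeLaw_singleton_of_notMem (ζ : Fin K → PMF (Word K)) (i : Fin K) {T : Tree K}
    (hT : T ∉ Set.range (buildTree i)) : treeLaw ζ i {T} = 0 := by
  rw [treeLaw, MeasureTheory.Measure.map_apply (measurable_buildTree i) (measurableSet_singleton _),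
    Set.preimage_singleton_eq_empty.2 hT, MeasureTheory.measure_empty]

theorem count_eq_card_filter {α : Type*} [DecidableEq α] (a : α) (w : List α) :
    w.count a = ((Finset.range w.length).filter fun n => w[n]? = some a).card := by
  induction w using List.reverseRecOn with
  | nil => simp
  | append_singleton w b ih =>
    rw [List.count_append, ih, List.length_append, List.length_singleton, Finset.range_add_one,
      Finset.filter_insert]
    have h1 : (Finset.range w.length).filter (fun n => (w ++ [b])[n]? = some a) =
        (Finset.range w.length).filter (fun n => w[n]? = some a) := by
      refine Finset.filter_congr fun n hn => ?_
      rw [List.getElem?_append_left (Finset.mem_range.1 hn)]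
    rw [h1, List.getElem?_concat_length]
    by_cases hb : b = a
    · subst hb
      simp
    · simp [hb]

theorem typeCount_eq_card_filter {T : Tree K} {F : Finset (List ℕ × Fin K)}
    (hF : (F : Set (List ℕ × Fin K)) = T.typedVerts) (j : Fin K) :
    T.typeCount j = (F.filter fun p => p.2 = j).card := by
  have hmem : ∀ p, p ∈ F ↔ T.label p.1 = some p.2 := fun p => by
    rw [← Finset.mem_coe, hF]; rfl
  rw [Tree.typeCount, ← Set.ncard_coe_finset]
  refine Set.ncard_congr (fun u _ => (u, j)) (fun u hu => ?_) (fun u v _ _ h => ?_) fun p hp => ?_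
  · simpa [hmem] using hu
  · exact congrArg Prod.fst h
  · have hp' : T.label p.1 = some p.2 ∧ p.2 = j := by simpa [hmem] using hp
    exact ⟨p.1, by rw [← hp'.2]; exact hp'.1, by rw [← hp'.2]⟩

/-- Every vertex but the root is a child of exactly one vertex. -/
theorem sum_count_add_root (i : Fin K) (x : List ℕ × Fin K → Word K)
    {F : Finset (List ℕ × Fin K)} (hF : (F : Set (List ℕ × Fin K)) = (buildTree i x).typedVerts)
    (j : Fin K) :
    ∑ p ∈ F, (x p).count j + (if i = j then 1 else 0) = (buildTree i x).typeCount j := by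
  have hmem : ∀ p, p ∈ F ↔ treeLabel x i p.1 = some p.2 := fun p => by
    rw [← Finset.mem_coe, hF]; rfl
  rw [typeCount_eq_card_filter hF]
  have hroot : (F.filter fun p => p.2 = j ∧ p.1 = []).card = if i = j then 1 else 0 := by
    split_ifs with h
    · rw [Finset.card_eq_one]
      refine ⟨([], i), Finset.ext fun p => ?_⟩
      rw [Finset.mem_filter, hmem, Finset.mem_singleton]
      constructor
      · rintro ⟨-, h2, h3⟩
        exact Prod.ext h3 (h2.trans h.symm)
      · rintro rfl
        exact ⟨rfl, h, rfl⟩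
    · rw [Finset.card_eq_zero, Finset.filter_eq_empty_iff]
      rintro ⟨u, j'⟩ hp ⟨rfl, rfl⟩
      rw [hmem] at hp
      exact h (Option.some.inj hp)
  have hnonroot : (F.filter fun p => p.2 = j ∧ ¬ p.1 = []).card = ∑ p ∈ F, (x p).count j := by
    simp_rw [count_eq_card_filter]
    rw [← Finset.card_sigma]
    symm
    refine Finset.card_bij (fun q _ => (q.1.1 ++ [q.2], j)) ?_ ?_ ?_
    · rintro ⟨⟨u, j'⟩, n⟩ hq
      simp only [Finset.mem_sigma, Finset.mem_filter, hmem] at hq ⊢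
      refine ⟨?_, trivial, by simp⟩
      rw [treeLabel_append_singleton, hq.1]
      exact hq.2.2
    · rintro ⟨⟨u, j'⟩, n⟩ hq ⟨⟨v, j''⟩, m⟩ hr h
      simp only [Finset.mem_sigma, hmem] at hq hr
      obtain ⟨rfl, hnm⟩ := List.append_inj' (congrArg Prod.fst h) rfl
      obtain rfl : n = m := by simpa using hnm
      obtain rfl : j' = j'' := Option.some.inj (hq.1.symm.trans hr.1)
      rfl
    · rintro ⟨u, j'⟩ hp
      rw [Finset.mem_filter, hmem] at hp
      obtain ⟨hp, rfl, hu⟩ := hp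
      simp only at hp hu
      rw [← List.dropLast_append_getLast hu, treeLabel_append_singleton] at hp
      obtain ⟨m, hm, hm'⟩ := Option.bind_eq_some_iff.1 hp
      refine ⟨⟨(u.dropLast, m), u.getLast hu⟩, ?_, ?_⟩
      · simp only [Finset.mem_sigma, hmem, Finset.mem_filter, Finset.mem_range]
        exact ⟨hm, (List.getElem?_eq_some_iff.1 hm').1, hm'⟩
      · simp only [List.dropLast_append_getLast hu]
  rw [← hroot, ← hnonroot, add_comm, ← Finset.filter_filter, ← Finset.filter_filter,
    Finset.card_filter_add_card_filter_not]

/-! ### Tilting the law of the tree -/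

/-- Tilting multiplies the mass of a finite tree by a factor that depends on the tree only through
the pairing of its type counts with `χ(θ)`. -/
theorem treeLaw_wordTilting_singleton {μ : Fin K → PMF (Fin K → ℕ)} (h : IsEntire μ)
    {ζ : Fin K → PMF (Word K)} (hζ : projection ζ = μ) (θ : Fin K → ℝ) (i : Fin K) {T : Tree K}
    (hT : T.verts.Finite) :
    treeLaw (wordTilting ζ θ) i {T} =
      ENNReal.ofReal (Real.exp (-θ i - ∑ j, (T.typeCount j : ℝ) * chi μ θ j)) *
        treeLaw ζ i {T} := by
  by_cases hr : T ∈ Set.range (buildTree i)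
  swap
  · simp [treeLaw_singleton_of_notMem _ i hr]
  obtain ⟨x, rfl⟩ := hr
  have hF := (Tree.finite_typedVerts hT).coe_toFinset
  set F := (Tree.finite_typedVerts hT).toFinset
  rw [treeLaw_singleton _ i x hF, treeLaw_singleton _ i x hF]
  simp_rw [wordTilting_apply h hζ]
  rw [Finset.prod_mul_distrib, mul_comm, ← ENNReal.ofReal_prod_of_nonneg fun _ _ => (Real.exp_pos _).le,
    ← Real.exp_sum]
  congr 3
  rw [Finset.sum_sub_distrib, Finset.sum_comm]
  have h1 : ∀ j, ∑ p ∈ F, θ j * ((x p).count j : ℝ) =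
      θ j * (((buildTree i x).typeCount j : ℝ) - if i = j then 1 else 0) := by
    intro j
    rw [← sum_count_add_root i x hF j]
    push_cast
    rw [add_sub_cancel_right, Finset.mul_sum]
  have h2 : ∑ p ∈ F, Real.log (genFun μ p.2 (fun j => Real.exp (θ j))) =
      ∑ j, ((buildTree i x).typeCount j : ℝ) *
        Real.log (genFun μ j (fun j => Real.exp (θ j))) := by
    rw [← Finset.sum_fiberwise F (fun p => p.2)]
    refine Finset.sum_congr rfl fun j _ => ?_
    rw [typeCount_eq_card_filter hF, ← nsmul_eq_mul, ← Finset.sum_const]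
    exact Finset.sum_congr rfl fun p hp => by rw [(Finset.mem_filter.1 hp).2]
  rw [h2]
  simp_rw [h1, chi, mul_sub, Finset.sum_sub_distrib]
  simp only [mul_ite, mul_one, mul_zero, Finset.sum_ite_eq, Finset.mem_univ, if_true]
  simp_rw [mul_comm (θ _)]
  ring

theorem measure_eq_of_countable {α : Type*} [MeasurableSpace α] [MeasurableSingletonClass α]
    {ν ν' : MeasureTheory.Measure α} {c : ℝ≥0∞} {A : Set α} (hA : A.Countable)
    (h : ∀ a ∈ A, ν' {a} = c * ν {a}) : ν' A = c * ν A := by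
  have key : ∀ m : MeasureTheory.Measure α, m A = ∑' a : A, m {(a : α)} := fun m => by
    conv_lhs => rw [← Set.biUnion_of_singleton A]
    exact MeasureTheory.measure_biUnion hA (fun a _ b _ hab => by simpa using hab)
      fun a _ => measurableSet_singleton a
  rw [key, key, ← ENNReal.tsum_mul_left]
  exact tsum_congr fun a => h a a.2

/-- If `χ(θ)` is a multiple of a row of `Γ`, tilting by `θ` multiplies the law of the tree by a
constant on the event `Γ N = g`. -/
theorem treeLaw_wordTilting {μ : Fin K → PMF (Fin K → ℕ)} (h : IsEntire μ)
    {ζ : Fin K → PMF (Word K)} (hζ : projection ζ = μ) {θ : Fin K → ℝ}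
    {Γ : Matrix (Fin l) (Fin K) ℤ} {m : Fin l} {t : ℝ} (hθ : ∀ j, chi μ θ j = t * (Γ m j : ℝ))
    (i : Fin K) (g : Fin l → ℤ) {A : Set (Tree K)} (hA : A ⊆ sizeEvent Γ g) :
    treeLaw (wordTilting ζ θ) i A =
      ENNReal.ofReal (Real.exp (-θ i - t * g m)) * treeLaw ζ i A := by
  refine measure_eq_of_countable (Tree.countable_finite.mono fun T hT => (hA hT).1) fun T hT => ?_
  rw [treeLaw_wordTilting_singleton h hζ θ i (hA hT).1, ← (hA hT).2]
  congr 4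
  simp only [hθ, Matrix.mulVec, dotProduct]
  push_cast
  rw [Finset.mul_sum]
  exact Finset.sum_congr rfl fun j _ => by ring

theorem measurableSet_sizeEvent (Γ : Matrix (Fin l) (Fin K) ℤ) (g : Fin l → ℤ) :
    MeasurableSet (sizeEvent Γ g) :=
  (Tree.countable_finite.mono fun _ hT => hT.1).measurableSet

theorem conditionedLaw_wordTilting {μ : Fin K → PMF (Fin K → ℕ)} (h : IsEntire μ)
    {ζ : Fin K → PMF (Word K)} (hζ : projection ζ = μ) {θ : Fin K → ℝ}
    {Γ : Matrix (Fin l) (Fin K) ℤ} {m : Fin l} {t : ℝ} (hθ : ∀ j, chi μ θ j = t * (Γ m j : ℝ))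
    (i : Fin K) (g : Fin l → ℤ) :
    conditionedLaw (wordTilting ζ θ) i Γ g = conditionedLaw ζ i Γ g := by
  have hE := measurableSet_sizeEvent Γ g
  refine MeasureTheory.Measure.ext fun s _ => ?_
  have hc0 : ENNReal.ofReal (Real.exp (-θ i - t * g m)) ≠ 0 :=
    (ENNReal.ofReal_pos.2 (Real.exp_pos _)).ne'
  have hct : ENNReal.ofReal (Real.exp (-θ i - t * g m)) ≠ ∞ := ENNReal.ofReal_ne_top
  rw [conditionedLaw, conditionedLaw, ProbabilityTheory.cond_apply hE,
    ProbabilityTheory.cond_apply hE, treeLaw_wordTilting h hζ hθ i g subset_rfl,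
    treeLaw_wordTilting h hζ hθ i g Set.inter_subset_left,
    ENNReal.mul_inv (Or.inl hc0) (Or.inl hct), mul_mul_mul_comm, ENNReal.inv_mul_cancel hc0 hct,
    one_mul]

/-! ### Linear forms dominated by combinations of the `χ_i` -/

/-- The linear form `θ ↦ ∑ x_j θ_j` is at most `∑ a_i χ_i(θ)`, up to an additive constant. The
pairs `(x, a)` with this property form a convex cone. -/
def Dominates (μ : Fin K → PMF (Fin K → ℕ)) (x a : Fin K → ℝ) : Prop :=
  ∃ C : ℝ, ∀ θ, ∑ j, x j * θ j ≤ ∑ i, a i * chi μ θ i + C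

namespace Dominates

variable {μ : Fin K → PMF (Fin K → ℕ)} {x y a b : Fin K → ℝ}

theorem add (h : Dominates μ x a) (h' : Dominates μ y b) : Dominates μ (x + y) (a + b) := by
  obtain ⟨C, hC⟩ := h
  obtain ⟨D, hD⟩ := h'
  refine ⟨C + D, fun θ => ?_⟩
  simp only [Pi.add_apply, add_mul, Finset.sum_add_distrib]
  linarith [hC θ, hD θ]

theorem smul {c : ℝ} (hc : 0 ≤ c) (h : Dominates μ x a) : Dominates μ (c • x) (c • a) := by
  obtain ⟨C, hC⟩ := h
  refine ⟨c * C, fun θ => ?_⟩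
  simp only [Pi.smul_apply, smul_eq_mul, mul_assoc, ← Finset.mul_sum]
  rw [← mul_add]
  exact mul_le_mul_of_nonneg_left (hC θ) hc

theorem zero : Dominates μ 0 0 := ⟨0, fun θ => by simp⟩

theorem sum {ι : Type*} (s : Finset ι) {x a : ι → Fin K → ℝ}
    (h : ∀ i ∈ s, Dominates μ (x i) (a i)) : Dominates μ (∑ i ∈ s, x i) (∑ i ∈ s, a i) := by
  classical
  induction s using Finset.induction_on with
  | empty => exact zero
  | insert i s hi ih =>
    rw [Finset.sum_insert hi, Finset.sum_insert hi]
    exact (h i (Finset.mem_insert_self i s)).add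
      (ih fun j hj => h j (Finset.mem_insert_of_mem hj))

end Dominates

/-- The increment of the vector of type counts of the unexplored individuals when an individual of
type `i` is replaced by its children, counted by `k`. -/
def increment (i : Fin K) (k : Fin K → ℕ) : Fin K → ℝ :=
  fun j => (k j : ℝ) - (Pi.single i 1 : Fin K → ℝ) j

/-- The affine minorant `le_chi` of `χ_i`, read as an element of the cone. -/
theorem dominates_increment {μ : Fin K → PMF (Fin K → ℕ)} (h : IsEntire μ) {i : Fin K}
    {k : Fin K → ℕ} (hk : k ∈ (μ i).support) : Dominates μ (increment i k) (Pi.single i 1) := by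
  refine ⟨-Real.log (μ i k).toReal, fun θ => ?_⟩
  have := le_chi h hk θ
  have h1 : ∑ j, increment i k j * θ j = ∑ j, θ j * (k j : ℝ) - θ i := by
    simp [increment, sub_mul, Pi.single_apply, mul_comm (θ _)]
  have h2 : ∑ i', (Pi.single i 1 : Fin K → ℝ) i' * chi μ θ i' = chi μ θ i := by
    simp [Pi.single_apply]
  rw [h1, h2]
  linarith

/-- The linear form `x` is dominated by some nonnegative combination of the `χ_i`. -/
def IsDominated (μ : Fin K → PMF (Fin K → ℕ)) (x : Fin K → ℝ) : Prop :=
  ∃ a, 0 ≤ a ∧ Dominates μ x a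

namespace IsDominated

variable {μ : Fin K → PMF (Fin K → ℕ)} {x y : Fin K → ℝ}

theorem add (h : IsDominated μ x) (h' : IsDominated μ y) : IsDominated μ (x + y) := by
  obtain ⟨a, ha, h⟩ := h
  obtain ⟨b, hb, h'⟩ := h'
  exact ⟨a + b, add_nonneg ha hb, h.add h'⟩

theorem smul {c : ℝ} (hc : 0 ≤ c) (h : IsDominated μ x) : IsDominated μ (c • x) := by
  obtain ⟨a, ha, h⟩ := h
  exact ⟨c • a, smul_nonneg hc ha, h.smul hc⟩

theorem sum {ι : Type*} (s : Finset ι) {x : ι → Fin K → ℝ}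
    (h : ∀ i ∈ s, IsDominated μ (x i)) : IsDominated μ (∑ i ∈ s, x i) := by
  choose! a ha h using h
  exact ⟨∑ i ∈ s, a i, Finset.sum_nonneg ha, Dominates.sum s h⟩

end IsDominated

theorem isDominated_increment {μ : Fin K → PMF (Fin K → ℕ)} (h : IsEntire μ) {i : Fin K}
    {k : Fin K → ℕ} (hk : k ∈ (μ i).support) : IsDominated μ (increment i k) :=
  ⟨_, Pi.single_nonneg.2 zero_le_one, dominates_increment h hk⟩

/-- The increments along a finite tree with root of type `i` add up to `-e_i`. -/
theorem isDominated_neg_single {μ : Fin K → PMF (Fin K → ℕ)} (h : IsEntire μ) (hfin : IsFinite μ)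
    (i : Fin K) : IsDominated μ (-Pi.single i 1) := by
  obtain ⟨ζ, rfl, hζ⟩ := hfin
  obtain ⟨T, hT, hpos⟩ : ∃ T : Tree K, T.verts.Finite ∧ treeLaw ζ i {T} ≠ 0 := by
    by_contra! hn
    have := measure_eq_of_countable (ν := 0) (ν' := treeLaw ζ i) (c := 1) Tree.countable_finite
      fun T hT => by simpa using hn T hT
    exact (hζ i).ne' (by simpa using this)
  obtain ⟨x, rfl⟩ : T ∈ Set.range (buildTree i) := by
    by_contra hr
    exact hpos (treeLaw_singleton_of_notMem ζ i hr)
  have hF := (Tree.finite_typedVerts hT).coe_toFinset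
  set F := (Tree.finite_typedVerts hT).toFinset
  rw [treeLaw_singleton ζ i x hF, Finset.prod_ne_zero_iff] at hpos
  have hsum := IsDominated.sum (μ := projection ζ) F
    (x := fun p => increment p.2 (fun j => (x p).count j)) fun p hp => by
      refine isDominated_increment h ?_
      rw [projection, PMF.mem_support_map_iff]
      exact ⟨x p, (PMF.mem_support_iff _ _).2 (hpos p hp), rfl⟩
  convert hsum using 1
  ext j
  simp only [increment, Finset.sum_apply, Finset.sum_sub_distrib, Pi.neg_apply]
  have h1 := sum_count_add_root i x hF j
  rw [typeCount_eq_card_filter hF, Finset.card_filter] at h1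
  have h2 : ∑ p ∈ F, (Pi.single p.2 1 : Fin K → ℝ) j =
      ((∑ p ∈ F, if p.2 = j then 1 else 0 : ℕ) : ℝ) := by
    push_cast
    exact Finset.sum_congr rfl fun p _ => by simp [Pi.single_apply, eq_comm]
  rw [h2, ← h1]
  push_cast
  simp [Pi.single_apply, eq_comm]

theorem IsDominated.mono {μ : Fin K → PMF (Fin K → ℕ)} (h : IsEntire μ) (hfin : IsFinite μ)
    {x y : Fin K → ℝ} (hxy : x ≤ y) (hy : IsDominated μ y) : IsDominated μ x := by
  have := hy.add (IsDominated.sum Finset.univ fun i _ =>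
    (isDominated_neg_single h hfin i).smul (sub_nonneg.2 (hxy i)))
  convert this using 1
  ext j
  simp [Pi.single_apply]

theorem isDominated_single_sub_single {μ : Fin K → PMF (Fin K → ℕ)} (h : IsEntire μ)
    (hfin : IsFinite μ) (hirr : IsIrreducible μ) (i j : Fin K) :
    IsDominated μ (Pi.single j 1 - Pi.single i 1) := by
  induction hirr.reflTransGen i j with
  | refl =>
    rw [sub_self]
    exact ⟨0, le_rfl, Dominates.zero⟩
  | @tail m j _ hmj ih =>
    obtain ⟨k, hk, hkj⟩ := hmj
    have hle : (Pi.single j 1 - Pi.single m 1 : Fin K → ℝ) ≤ increment m k := by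
      intro j'
      simp only [increment, Pi.sub_apply]
      refine sub_le_sub_right ?_ _
      by_cases hj : j' = j
      · subst hj
        simpa using Nat.one_le_iff_ne_zero.2 hkj.ne'
      · simp [hj]
    have := ih.add ((isDominated_increment h hk).mono h hfin hle)
    rwa [add_comm, sub_add_sub_cancel] at this

/-- Extinction supplies the vectors `-e_j`, irreducibility the differences `e_j - e_i`, and
nondegeneracy some `e_i`; together they span everything as a cone. -/
theorem isDominated_all {μ : Fin K → PMF (Fin K → ℕ)} (h : IsEntire μ) (hfin : IsFinite μ)
    (hnd : IsNondegenerate μ) (hirr : IsIrreducible μ) (x : Fin K → ℝ) : IsDominated μ x := by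
  obtain ⟨i, hi⟩ := hnd
  obtain ⟨k, hk, hk2⟩ : ∃ k ∈ (μ i).support, 2 ≤ ∑ j, k j := by
    by_contra! hn
    refine hi.ne' ((PMF.toMeasure_apply_eq_zero_iff _ MeasurableSet.of_discrete).2 ?_)
    exact Set.disjoint_left.2 fun k hk hk' => absurd hk' (not_le.2 (hn k hk))
  have hei : IsDominated μ (Pi.single i 1) := by
    have h1 := (isDominated_increment h hk).add (IsDominated.sum Finset.univ fun j _ =>
      (isDominated_single_sub_single h hfin hirr j i).smul (Nat.cast_nonneg (k j)))
    have hpos : (0 : ℝ) < ∑ j, (k j : ℝ) - 1 := by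
      have : (2 : ℝ) ≤ ∑ j, (k j : ℝ) := by exact_mod_cast hk2
      linarith
    convert h1.smul (inv_nonneg.2 hpos.le) using 1
    rw [eq_inv_smul_iff₀ hpos.ne']
    ext m
    simp only [increment, Pi.add_apply, Pi.smul_apply, Finset.sum_apply, Pi.sub_apply,
      smul_eq_mul, mul_sub, Finset.sum_sub_distrib, ← Finset.sum_mul]
    simp only [Pi.single_apply, mul_ite, mul_one, mul_zero, Finset.sum_ite_eq, Finset.mem_univ,
      if_true]
    split_ifs <;> ring
  have hej : ∀ j, IsDominated μ (Pi.single j 1) := fun j => by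
    have := hei.add (isDominated_single_sub_single h hfin hirr i j)
    rwa [add_sub_cancel] at this
  refine (IsDominated.sum Finset.univ fun j _ => (hej j).smul (abs_nonneg (x j))).mono h hfin ?_
  intro j
  simpa [Pi.single_apply] using le_abs_self (x j)

/-- The linear forms `x` such that `±x` are dominated by one and the same nonnegative combination
of the `χ_i`. -/
def dominatedSubmodule (μ : Fin K → PMF (Fin K → ℕ)) : Submodule ℝ (Fin K → ℝ) where
  carrier := {x | ∃ a, 0 ≤ a ∧ Dominates μ x a ∧ Dominates μ (-x) a}
  add_mem' := by
    rintro x y ⟨a, ha, h1, h2⟩ ⟨b, hb, h3, h4⟩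
    refine ⟨a + b, add_nonneg ha hb, h1.add h3, ?_⟩
    rw [neg_add]
    exact h2.add h4
  zero_mem' := ⟨0, le_rfl, Dominates.zero, by rw [neg_zero]; exact Dominates.zero⟩
  smul_mem' := by
    rintro c x ⟨a, ha, h1, h2⟩
    refine ⟨|c| • a, smul_nonneg (abs_nonneg c) ha, ?_⟩
    rcases le_total 0 c with hc | hc
    · rw [abs_of_nonneg hc, ← smul_neg]
      exact ⟨h1.smul hc, h2.smul hc⟩
    · rw [abs_of_nonpos hc, ← neg_smul, ← neg_smul_neg c x]
      exact ⟨h2.smul (neg_nonneg.2 hc), h1.smul (neg_nonneg.2 hc)⟩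

/-- The submodule contains the differences of atoms of each `μ i`, which span the whole space when
`μ` is nonlocalized. -/
theorem dominatedSubmodule_eq_top {μ : Fin K → PMF (Fin K → ℕ)} (h : IsEntire μ)
    (hfin : IsFinite μ) (hnd : IsNondegenerate μ) (hnl : IsNonlocalized μ)
    (hirr : IsIrreducible μ) : dominatedSubmodule μ = ⊤ := by
  have hdiff : ∀ i, ∀ k ∈ (μ i).support, ∀ k' ∈ (μ i).support,
      increment i k - increment i k' ∈ dominatedSubmodule μ := by
    intro i k hk k' hk'
    obtain ⟨b, hb, hkb⟩ := isDominated_all h hfin hnd hirr (-increment i k)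
    obtain ⟨b', hb', hkb'⟩ := isDominated_all h hfin hnd hirr (-increment i k')
    have hi : (0 : Fin K → ℝ) ≤ Pi.single i 1 := Pi.single_nonneg.2 zero_le_one
    have h1 := dominates_increment h hk
    have h2 := dominates_increment h hk'
    refine ⟨(Pi.single i 1 + b) + (Pi.single i 1 + b'),
      add_nonneg (add_nonneg hi hb) (add_nonneg hi hb'), ?_, ?_⟩
    · convert (h1.add hkb).add (h1.add hkb') using 1
      abel
    · convert (h2.add hkb).add (h2.add hkb') using 1
      abel
  by_contra hne
  obtain ⟨f, hf, hle⟩ := Submodule.exists_le_ker_of_lt_top _ (lt_top_iff_ne_top.2 hne)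
  have hfs : ∀ v : Fin K → ℝ, f v = ∑ j, f (Pi.single j 1) * v j := fun v => by
    rw [LinearMap.pi_apply_eq_sum_univ f v]
    refine Finset.sum_congr rfl fun j _ => ?_
    rw [smul_eq_mul, mul_comm]
    congr 2
    ext j'
    simp [Pi.single_apply, eq_comm]
  obtain ⟨i, hi⟩ := hnl (fun j => f (Pi.single j 1)) fun h0 => hf <| LinearMap.ext fun v => by
    rw [hfs, LinearMap.zero_apply]
    exact Finset.sum_eq_zero fun j _ => by rw [congrFun h0 j, Pi.zero_apply, zero_mul]
  obtain ⟨k₀, hk₀⟩ := (μ i).support_nonempty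
  refine hi ⟨∑ j, f (Pi.single j 1) * (k₀ j : ℝ), fun k hk => ?_⟩
  have := hle (hdiff i k hk k₀ hk₀)
  rw [LinearMap.mem_ker, hfs] at this
  rw [← sub_eq_zero, ← Finset.sum_sub_distrib, ← this]
  refine Finset.sum_congr rfl fun j _ => ?_
  simp only [increment, Pi.sub_apply]
  ring

/-- Adding up combinations that dominate the forms `± θ_j` for the various `j` gives a coercive
one. -/
theorem exists_coercive {μ : Fin K → PMF (Fin K → ℕ)} (h : dominatedSubmodule μ = ⊤) :
    ∃ (a : Fin K → ℝ) (C : ℝ), 0 ≤ a ∧ ∀ θ j, |θ j| ≤ ∑ i, a i * chi μ θ i + C := by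
  have hmem : ∀ j, (Pi.single j 1 : Fin K → ℝ) ∈ dominatedSubmodule μ := fun j => by
    rw [h]; trivial
  choose a ha hpos hneg using hmem
  have h0 : ∀ m, Dominates μ 0 (a m) := fun m => by
    have := ((hpos m).add (hneg m)).smul (c := 1 / 2) (by norm_num)
    rw [add_neg_cancel, smul_zero, ← two_smul ℝ, smul_smul] at this
    simpa using this
  have hall : ∀ (j : Fin K) (x : Fin K → ℝ), Dominates μ x (a j) → Dominates μ x (∑ m, a m) := by
    intro j x hx
    have := Dominates.sum (μ := μ) Finset.univ (x := fun m => if m = j then x else 0) (a := a)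
      fun m _ => by
        split_ifs with hm
        · rwa [hm]
        · exact h0 m
    simpa using this
  choose C hC using fun j => hall j _ (hpos j)
  choose D hD using fun j => hall j _ (hneg j)
  refine ⟨∑ m, a m, ∑ j, (|C j| + |D j|), Finset.sum_nonneg fun m _ => ha m, fun θ j => ?_⟩
  have hle : |C j| + |D j| ≤ ∑ j, (|C j| + |D j|) :=
    Finset.single_le_sum (f := fun j => |C j| + |D j|) (fun _ _ => by positivity)
      (Finset.mem_univ j)
  have h1 := hC j θ
  have h2 := hD j θ
  simp only [Pi.neg_apply, neg_mul, Finset.sum_neg_distrib] at h2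
  have hs : ∑ m, (Pi.single j 1 : Fin K → ℝ) m * θ m = θ j := by simp [Pi.single_apply]
  rw [hs] at h1 h2
  refine abs_le'.2 ⟨?_, ?_⟩
  · linarith [le_abs_self (C j), abs_nonneg (D j)]
  · linarith [le_abs_self (D j), abs_nonneg (C j)]

/-- The vectors `b ≥ 0` with `∑ b_i χ_i` bounded below are not all orthogonal to a given `r ≠ 0`. -/
theorem exists_bddBelow_not_orthogonal {μ : Fin K → PMF (Fin K → ℕ)} (he : IsEntire μ)
    (h : dominatedSubmodule μ = ⊤) {r : Fin K → ℝ} (hr : r ≠ 0) :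
    ∃ (b : Fin K → ℝ) (D : ℝ), 0 ≤ b ∧ (∀ θ, -D ≤ ∑ i, b i * chi μ θ i) ∧
      ∑ i, b i * r i ≠ 0 := by
  obtain ⟨i, hi⟩ := Function.ne_iff.1 hr
  obtain ⟨k, hk⟩ := (μ i).support_nonempty
  obtain ⟨b, hb, h1, h2⟩ : increment i k ∈ dominatedSubmodule μ := by rw [h]; trivial
  suffices hex : ∃ b', 0 ≤ b' ∧ Dominates μ 0 b' ∧ ∑ i, b' i * r i ≠ 0 by
    obtain ⟨b', hb', ⟨D, hD⟩, hbr⟩ := hex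
    refine ⟨b', D, hb', fun θ => ?_, hbr⟩
    have := hD θ
    simp only [Pi.zero_apply, zero_mul, Finset.sum_const_zero] at this
    linarith
  -- Both `b + b` and `e_i + b` will do for the domination of `0`, and as `r_i ≠ 0` they are not both
  -- orthogonal to `r`.
  by_cases hbr : ∑ i, b i * r i = 0
  · refine ⟨Pi.single i 1 + b, add_nonneg (Pi.single_nonneg.2 zero_le_one) hb, ?_, ?_⟩
    · rw [← add_neg_cancel (increment i k)]
      exact (dominates_increment he hk).add h2
    · simpa [add_mul, Finset.sum_add_distrib, hbr, Pi.single_apply] using hi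
  · refine ⟨b + b, add_nonneg hb hb, ?_, ?_⟩
    · rw [← add_neg_cancel (increment i k)]
      exact h1.add h2
    · simpa [add_mul, Finset.sum_add_distrib] using hbr

/-! ### The critical tilting -/

/-- On every line through the origin there is a value of `χ` at a critical tilting. -/
theorem exists_critical_tilting {μ : Fin K → PMF (Fin K → ℕ)} (h : IsEntire μ) (hfin : IsFinite μ)
    (hnd : IsNondegenerate μ) (hnl : IsNonlocalized μ) (hirr : IsIrreducible μ)
    {r : Fin K → ℝ} (hr : r ≠ 0) :
    ∃ (t : ℝ) (θ : Fin K → ℝ), (∀ i, chi μ θ i = t * r i) ∧ IsCritical (tilting μ θ) := by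
  have htop := dominatedSubmodule_eq_top h hfin hnd hnl hirr
  obtain ⟨a, C, ha, hcoer⟩ := exists_coercive htop
  obtain ⟨b, D, hb, hbdd, hbr⟩ := exists_bddBelow_not_orthogonal h htop hr
  obtain ⟨t, θ, c, hθ, hc0, hcne, hc⟩ := exists_boundary_point (convexOn_chi h) (continuous_chi h)
    (chi_zero μ) ha hb hcoer hbdd hbr
  have hle : ∑ i, c i * chi μ θ i ≤ ∑ i, c i * (t * r i) :=
    Finset.sum_le_sum fun i _ => mul_le_mul_of_nonneg_left (hθ i) (hc0 i)
  -- The gradient of `∑ c_i χ_i` vanishes at its minimizer `θ`: `c` is a left eigenvector.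
  have heig : ∀ j, ∑ i, c i * meanMatrix (tilting μ θ) i j = c j := by
    intro j
    have hder := HasDerivAt.fun_sum (u := Finset.univ)
      fun i (_ : i ∈ Finset.univ) => (hasDerivAt_chi h θ i j).const_mul (c i)
    have hmin : IsLocalMin (fun s : ℝ => ∑ i, c i * chi μ (θ + Pi.single j s) i) 0 :=
      Filter.Eventually.of_forall fun s => by
        beta_reduce
        rw [Pi.single_zero, add_zero]
        exact le_trans hle (hc _)
    have := hmin.hasDerivAt_eq_zero hder
    simp only [mul_sub, Finset.sum_sub_distrib, Matrix.one_apply, mul_ite, mul_one, mul_zero,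
      Finset.sum_ite_eq', Finset.mem_univ, if_true] at this
    linarith
  have hnonneg := meanMatrix_nonneg (tilting μ θ)
  obtain ⟨i₀, hi₀⟩ := Function.ne_iff.1 hcne
  have hcpos : ∀ j, 0 < c j := by
    intro j
    induction hirr.reflTransGen i₀ j with
    | refl => exact lt_of_le_of_ne (hc0 i₀) (Ne.symm hi₀)
    | @tail m j _ hmj ih =>
      rw [← heig j]
      exact Finset.sum_pos' (fun i _ => mul_nonneg (hc0 i) (hnonneg i j))
        ⟨m, Finset.mem_univ m, mul_pos ih (hmj.meanMatrix_tilting_pos h θ)⟩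
  refine ⟨t, θ, fun i => ?_, spectralRadius_eq_one hnonneg hcpos heig i₀⟩
  have heq := (Finset.sum_eq_sum_iff_of_le fun i _ =>
    mul_le_mul_of_nonneg_left (hθ i) (hc0 i)).1 (le_antisymm hle (hc θ)) i (Finset.mem_univ i)
  exact mul_left_cancel₀ (hcpos i).ne' heq

end BGW

theorem mainTheorem2 {K l : ℕ} (μ : Fin K → PMF (Fin K → ℕ))
    (h_entire : BGW.IsEntire μ) (h_finite : BGW.IsFinite μ)
    (h_nondegenerate : BGW.IsNondegenerate μ) (h_nonlocalized : BGW.IsNonlocalized μ)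
    (h_irreducible : BGW.IsIrreducible μ)
    (Γ : Matrix (Fin l) (Fin K) ℤ) (hΓ : Γ ≠ 0) :
    ∃ θ : Fin K → ℝ, BGW.GammaEquiv μ Γ θ 0 ∧ BGW.IsCritical (BGW.tilting μ θ) ∧
      ∀ ζ : Fin K → PMF (BGW.Word K), BGW.projection ζ = μ →
        BGW.projection (BGW.wordTilting ζ θ) = BGW.tilting μ θ ∧
        ∀ (i : Fin K) (g : Fin l → ℤ),
          (0 < BGW.treeLaw ζ i (BGW.sizeEvent Γ g) ↔
            0 < BGW.treeLaw (BGW.wordTilting ζ θ) i (BGW.sizeEvent Γ g)) ∧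
          (0 < BGW.treeLaw ζ i (BGW.sizeEvent Γ g) →
            BGW.conditionedLaw ζ i Γ g = BGW.conditionedLaw (BGW.wordTilting ζ θ) i Γ g) := by
  obtain ⟨m, hm⟩ := Function.ne_iff.1 hΓ
  obtain ⟨t, θ, hθ, hcrit⟩ := BGW.exists_critical_tilting h_entire h_finite h_nondegenerate
    h_nonlocalized h_irreducible (r := fun j => (Γ m j : ℝ)) fun h0 => hm <| funext fun j => by
      exact Int.cast_eq_zero.1 (congrFun h0 j)
  refine ⟨θ, fun v hv => ?_, hcrit, fun ζ hζ =>
    ⟨BGW.projection_wordTilting h_entire hζ θ, fun i g => ⟨?_, fun _ =>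
      (BGW.conditionedLaw_wordTilting h_entire hζ hθ i g).symm⟩⟩⟩
  · have hrow : ∑ j, (Γ m j : ℝ) * v j = 0 := congrFun hv m
    rw [BGW.chi_zero, sub_zero, dotProduct]
    simp_rw [hθ, mul_assoc, ← Finset.mul_sum, hrow, mul_zero]
  · rw [BGW.treeLaw_wordTilting h_entire hζ hθ i g subset_rfl, pos_iff_ne_zero, pos_iff_ne_zero,
      mul_ne_zero_iff]
    exact ⟨fun h => ⟨(ENNReal.ofReal_pos.2 (Real.exp_pos _)).ne', h⟩, fun h => h.2⟩
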